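/- Let $X,Y,W$ be real Banach spaces with $W\neq\{0\}$, with topological duals $X^*,Y^*$, closed unit balls $B_X$, etc., and unit spheres $S_X$, etc. Equip $X\times Y^*$ with the norm $\|(x,y^*)\|=\|x\|+\|y^*\|$. For $p\in X\times Y^*$ put $\Gamma(p)=\{p,-p\}$, and let $d_H$ be the Hausdorff distance, so that $d_H(\Gamma(p),\Gamma(q))=\min(\|p-q\|,\|p+q\|)$. Let $L$ be a nonempty, symmetric ($-L=L$), closed subset of $S_X\times S_{Y^*}$ with property $(P)$: for every sufficiently small $\varepsilon>0$ there is $\varpi(\varepsilon)>0$ such that for every $(x,y^*)\in L$ there is $(x^*_\varepsilon,y_\varepsilon)\in B_{X^*}\times B_Y$ with, for all $(z,t^*)\in L$, $$d_H(\Gamma(x,y^*),\Gamma(z,t^*))\ge\varepsilon\ \Longrightarrow\ x^*_\varepsilon(x)+y^*(y_\varepsilon)-\varpi(\varepsilon)\ \ge\ |x^*_\varepsilon(z)|+|t^*(y_\varepsilon)|.$$ Let $C_{b,e}(L,W)$ be the space of bounded continuous maps $\Phi:L\to W$ with $\Phi(-p)=\Phi(p)$ for all $p\in L$, with the sup-norm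 $\|\cdot\|_\infty$. Say that $\Phi\in C_{b,e}(L,W)$ attains $d_H$-strongly its maximum on $L$ if there is $p_0\in L$ such that $\|\Phi(p_0)\|=\sup_{p\in L}\|\Phi(p)\|$ and such that $d_H(\Gamma(p_n),\Gamma(p_0))\to0$ for every sequence $(p_n)$ in $L$ with $\|\Phi(p_n)\|\to\sup_{p\in L}\|\Phi(p)\|$. Let $\mathcal Z$ be a linear subspace of $C_{b,e}(L,W)$ that is a Banach space under a norm $\|\cdot\|_{\mathcal Z}$ such that: (i) $\|\Phi\|_{\mathcal Z}\ge\|\Phi\|_\infty$ for all $\Phi\in\mathcal Z$; (ii) for every bounded finite rank linear operator $T:X\to Y$ and every $w\in W$, the map $[T]\oplus w:L\to W$, $(x,y^*)\mapsto y^*(Tx)\,w$, belongs to $\mathcal Z$ and $\|[T]\oplus w\|_{\mathcal Z}\le\|T\|\,\|w\|$. A subset $A$ of a metric space $M$ is porous if there are $\lambda_0\in(0,1]$ and $r_0>0$ such that for all $x\in M$ and $r\in(0,r_0]$ there is $y\in M$ such that the open ball $B(y,\lambda_0r)$ is contained in $B(x,r)\cap(M\setminus A)$; it is $\sigma$-porous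 if it is a countable union of porous sets. Then: (1) for every $\Theta\in C_{b,e}(L,W)$ the set $$\mathcal G(\Theta)=\{\Phi\in\mathcal Z:\ \Theta+\Phi\text{ attains }d_H\text{-strongly its maximum on }L\}$$ is the complement of a $\sigma$-porous subset of $(\mathcal Z,\|\cdot\|_{\mathcal Z})$; (2) for every $\varepsilon>0$ there is $\eta(\varepsilon)>0$ such that whenever $\Phi\in\mathcal Z$ with $\|\Phi\|_\infty=1$ and $(x,y^*)\in L$ satisfy $\|\Phi(x,y^*)\|>1-\eta(\varepsilon)$, there are $\Psi\in\mathcal Z$ with $\|\Psi\|_\infty=1$ and $(z,t^*)\in L$ such that $$\|\Psi(z,t^*)\|=1,\qquad \|x-z\|+\|y^*-t^*\|<\varepsilon\qquad\text{and}\qquad \|\Psi-\Phi\|_\infty<\varepsilon.$$ -/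

import Mathlib

open Filter Topology Set
open scoped BoundedContinuousFunction

/-- Porous subsets of a metric space: one ratio `c` and one radius `r₀` serve all points. -/
def IsPorousIn {M : Type*} [PseudoMetricSpace M] (A : Set M) : Prop :=
  ∃ c : ℝ, 0 < c ∧ c ≤ 1 ∧ ∃ r₀ : ℝ, 0 < r₀ ∧
    ∀ x : M, ∀ r : ℝ, 0 < r → r ≤ r₀ →
      ∃ y : M, Metric.ball y (c * r) ⊆ Metric.ball x r ∩ Aᶜ

/-- Countable unions of porous sets. -/
def IsSigmaPorousIn {M : Type*} [PseudoMetricSpace M] (A : Set M) : Prop :=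
  ∃ P : ℕ → Set M, (∀ n, IsPorousIn (P n)) ∧ A = ⋃ n, P n

/-- The class `{x, -x}` of `x` modulo sign. -/
def signClass {V : Type*} [NormedAddCommGroup V] (x : V) : Set V := {x, -x}

/-- The Hausdorff distance between the sign classes of `x` and `y`. -/
noncomputable def signDist {V : Type*} [NormedAddCommGroup V] (x y : V) : ℝ :=
  Metric.hausdorffDist (signClass x) (signClass y)

/-- The space of bounded continuous even maps `L → W`, with the supremum norm.
Evenness is `Φ (-x) = Φ x`, written for pairs of points of `L` that are opposite in `V`. -/
def EvenBCF {V : Type*} [NormedAddCommGroup V] (L : Set V)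
    (W : Type*) [NormedAddCommGroup W] [NormedSpace ℝ W] : Submodule ℝ (L →ᵇ W) where
  carrier := {Φ | ∀ x y : L, (y : V) = -(x : V) → Φ y = Φ x}
  add_mem' := by
    intro f g hf hg x y h
    simp [hf x y h, hg x y h]
  zero_mem' := by
    intro x y _
    rfl
  smul_mem' := by
    intro c f hf x y h
    simp [hf x y h]

/-- `Φ` attains its maximum on `L` strongly for the Hausdorff distance of sign classes. -/
def AttainsStronglyModSign {V : Type*} [NormedAddCommGroup V] {L : Set V}
    {W : Type*} [NormedAddCommGroup W] [NormedSpace ℝ W] (Φ : EvenBCF L W) : Prop :=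
  ∃ x₀ : L, (⨆ x : L, ‖Φ.1 x‖) = ‖Φ.1 x₀‖ ∧
    ∀ u : ℕ → L,
      Tendsto (fun n => ‖Φ.1 (u n)‖) atTop (𝓝 (⨆ x : L, ‖Φ.1 x‖)) →
      Tendsto (fun n => signDist (u n : V) (x₀ : V)) atTop (𝓝 0)

/-- `X × Y*` with the norm `‖(x, y*)‖ = ‖x‖ + ‖y*‖`. -/
abbrev ProdDual (X Y : Type*) [NormedAddCommGroup X] [NormedSpace ℝ X]
    [NormedAddCommGroup Y] [NormedSpace ℝ Y] : Type _ :=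
  WithLp 1 (X × StrongDual ℝ Y)

/-- The property `(P)` for a subset of `X × Y*`. -/
def HasPropertyP {X Y : Type*} [NormedAddCommGroup X] [NormedSpace ℝ X]
    [NormedAddCommGroup Y] [NormedSpace ℝ Y] (L : Set (ProdDual X Y)) : Prop :=
  ∃ ε₀ : ℝ, 0 < ε₀ ∧ ∀ ε : ℝ, 0 < ε → ε < ε₀ →
    ∃ δ : ℝ, 0 < δ ∧ ∀ p ∈ L, ∃ (f : StrongDual ℝ X) (b : Y), ‖f‖ ≤ 1 ∧ ‖b‖ ≤ 1 ∧
      ∀ q ∈ L, ε ≤ signDist p q →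
        |f q.fst| + |q.snd b| ≤ f p.fst + p.snd b - δ

/-- The map `[T] ⊕ w : (x, y*) ↦ y*(T x) w`. -/
def opTensor {X Y W : Type*} [NormedAddCommGroup X] [NormedSpace ℝ X]
    [NormedAddCommGroup Y] [NormedSpace ℝ Y] [NormedAddCommGroup W] [NormedSpace ℝ W]
    (T : X →L[ℝ] Y) (w : W) : ProdDual X Y → W :=
  fun p => p.snd (T p.fst) • w

/-! Given `(x, y*)` in `L`, property `(P)` yields an operator of rank at most two, `T = f ⊗ e + g ⊗
b`, with `g` norming `x` and `e` almost norming `y*`. Then `y*(Tx)` is nearly `f x + y*(b)`, and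
`|t*(Tz)|` is smaller by a uniform gap when `(z, t*)` is far from `±(x, y*)`. If `p` almost
maximizes the norm of `Θ + Φ`, adding `s` times such a peak in the direction of the value at `p`
raises that value more than any far value can rise, and this survives perturbations of size
proportional to `s` (`HasPeaks.exists_perturbation`). Hence having no `ε`-small slice is a porous
condition. Slices of all sizes give a strong maximum by completeness, which proves (1). For (2), fix
`s`, perturb `Φ` at `p`, and use Baire to find a maximum-attaining function in the stability ball.
Its maximum point lies near `±p`, evenness corrects the sign, and normalizing costs little. -/

/-! ### Distance modulo sign. -/

theorem signDist_eq {V : Type*} [NormedAddCommGroup V] (x y : V) :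
    signDist x y = min ‖x - y‖ ‖x + y‖ := by
  have hxy : ‖-x - y‖ = ‖x + y‖ := by rw [← norm_neg]; congr 1; abel
  have hyx : ‖-x + y‖ = ‖x - y‖ := by rw [← norm_neg]; congr 1; abel
  have hinf : ∀ a b : V, Metric.infDist a (signClass b) = min ‖a - b‖ ‖a + b‖ := by
    intro a b
    have hne : (signClass b).Nonempty := ⟨b, Or.inl rfl⟩
    apply le_antisymm
    · refine le_min ?_ ?_
      · rw [← dist_eq_norm]
        exact Metric.infDist_le_dist_of_mem (Or.inl rfl)
      · have := Metric.infDist_le_dist_of_mem (x := a) (show -b ∈ signClass b from Or.inr rfl)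
        rwa [dist_eq_norm, sub_neg_eq_add] at this
    · refine (Metric.le_infDist hne).2 ?_
      rintro c (rfl | rfl)
      · rw [dist_eq_norm]; exact min_le_left _ _
      · rw [dist_eq_norm, sub_neg_eq_add]; exact min_le_right _ _
  have hfin : Metric.hausdorffEDist (signClass x) (signClass y) ≠ ⊤ := by
    refine Metric.hausdorffEDist_ne_top_of_nonempty_of_bounded ⟨x, Or.inl rfl⟩ ⟨y, Or.inl rfl⟩ ?_ ?_
    · exact (Set.toFinite {x, -x}).isBounded
    · exact (Set.toFinite {y, -y}).isBounded
  apply le_antisymm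
  · refine Metric.hausdorffDist_le_of_infDist (le_min (norm_nonneg _) (norm_nonneg _)) ?_ ?_
    · rintro c (rfl | rfl)
      · rw [hinf]
      · rw [hinf, hxy, hyx, min_comm]
    · rintro c (rfl | rfl)
      · rw [hinf, norm_sub_rev, add_comm]
      · rw [hinf, ← norm_neg (-y - x), ← norm_neg (-y + x), min_comm,
          show -(-y - x) = x + y by abel, show -(-y + x) = y - x by abel, norm_sub_rev,
          min_comm]
  · rw [← hinf]
    exact Metric.infDist_le_hausdorffDist_of_mem (Or.inl rfl) hfin

theorem signDist_comm {V : Type*} [NormedAddCommGroup V] (x y : V) :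
    signDist x y = signDist y x :=
  Metric.hausdorffDist_comm

theorem signDist_nonneg {V : Type*} [NormedAddCommGroup V] (x y : V) : 0 ≤ signDist x y :=
  Metric.hausdorffDist_nonneg

theorem signDist_triangle {V : Type*} [NormedAddCommGroup V] (x y z : V) :
    signDist x z ≤ signDist x y + signDist y z := by
  have h1 : ‖x - z‖ ≤ ‖x - y‖ + ‖y - z‖ := norm_sub_le_norm_sub_add_norm_sub x y z
  have h2 : ‖x + z‖ ≤ ‖x - y‖ + ‖y + z‖ := by
    have := norm_add_le (x - y) (y + z); rwa [show x - y + (y + z) = x + z by abel] at this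
  have h3 : ‖x + z‖ ≤ ‖x + y‖ + ‖y - z‖ := by
    have := norm_sub_le (x + y) (y - z); rwa [show x + y - (y - z) = x + z by abel] at this
  have h4 : ‖x - z‖ ≤ ‖x + y‖ + ‖y + z‖ := by
    have := norm_sub_le (x + y) (y + z); rwa [show x + y - (y + z) = x - z by abel] at this
  simp only [signDist_eq]
  rcases min_choice ‖x - y‖ ‖x + y‖ with h | h <;>
    rcases min_choice ‖y - z‖ ‖y + z‖ with h' | h' <;> rw [h, h']
  · exact (min_le_left _ _).trans h1
  · exact (min_le_right _ _).trans h2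
  · exact (min_le_right _ _).trans h3
  · exact (min_le_left _ _).trans h4

/-! ### Porosity and Baire category. -/

/-- A porous set avoids a dense open set. -/
theorem IsPorousIn.dense_interior_compl {M : Type*} [PseudoMetricSpace M] {A : Set M}
    (hA : IsPorousIn A) : Dense (interior Aᶜ) := by
  obtain ⟨c, hc, -, r₀, hr₀, h⟩ := hA
  refine Metric.dense_iff.2 fun x r hr => ?_
  obtain ⟨y, hy⟩ := h x (min r r₀) (lt_min hr hr₀) (min_le_right _ _)
  have hpos : 0 < c * min r r₀ := mul_pos hc (lt_min hr hr₀)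
  refine ⟨y, Metric.ball_subset_ball (min_le_left _ _) (hy (Metric.mem_ball_self hpos)).1, ?_⟩
  exact mem_interior.2 ⟨_, fun z hz => (hy hz).2, Metric.isOpen_ball, Metric.mem_ball_self hpos⟩

/-- In a complete space, the complement of a `σ`-porous set is dense. -/
theorem IsSigmaPorousIn.dense_compl {M : Type*} [PseudoMetricSpace M] [CompleteSpace M]
    {A : Set M} (hA : IsSigmaPorousIn A) : Dense Aᶜ := by
  obtain ⟨P, hP, rfl⟩ := hA
  refine (dense_iInter_of_isOpen_nat (f := fun n => interior (P n)ᶜ)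
    (fun n => isOpen_interior) fun n => (hP n).dense_interior_compl).mono ?_
  rw [compl_iUnion]
  exact iInter_mono fun n => interior_subset

/-! ### Peak operators from property `(P)`. -/

theorem abs_apply_le_one {E : Type*} [NormedAddCommGroup E] [NormedSpace ℝ E]
    {h : StrongDual ℝ E} {v : E} (h1 : ‖h‖ ≤ 1) (h2 : ‖v‖ ≤ 1) : |h v| ≤ 1 := by
  rw [← Real.norm_eq_abs]
  exact (h.le_of_opNorm_le h1 v).trans (by linarith)

/-- Property `(P)` yields finite rank operators `T` for which `|y*(T x)|` peaks at a prescribed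
point of `L`, up to sign. -/
theorem HasPropertyP.exists_peak_operator {X Y : Type*} [NormedAddCommGroup X] [NormedSpace ℝ X]
    [NormedAddCommGroup Y] [NormedSpace ℝ Y] {L : Set (ProdDual X Y)}
    (hL_sphere : ∀ p ∈ L, ‖p.fst‖ = 1 ∧ ‖p.snd‖ = 1) (hL_P : HasPropertyP L) :
    ∃ ε₀ : ℝ, 0 < ε₀ ∧ ∀ ε : ℝ, 0 < ε → ε < ε₀ → ∃ δ : ℝ, 0 < δ ∧ δ ≤ 1 ∧ ∀ p ∈ L,
      ∃ T : X →L[ℝ] Y, FiniteDimensional ℝ (T : X →ₗ[ℝ] Y).range ∧ ‖T‖ ≤ 2 ∧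
        0 ≤ p.snd (T p.fst) ∧
        ∀ q ∈ L, ε ≤ signDist p q → |q.snd (T q.fst)| ≤ p.snd (T p.fst) - δ := by
  obtain ⟨ε₀, hε₀, hP⟩ := hL_P
  refine ⟨ε₀, hε₀, fun ε hε hεlt => ?_⟩
  obtain ⟨δ, hδ, hP⟩ := hP ε hε hεlt
  refine ⟨min (δ / 2) 1, lt_min (half_pos hδ) one_pos, min_le_right _ _, fun p hp => ?_⟩
  -- Without far points `T = 0` works. Otherwise a far point forces the value at `p` to be
  -- nonnegative.
  by_cases hfar : ∃ q ∈ L, ε ≤ signDist p q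
  swap
  · push Not at hfar
    refine ⟨0, ?_, by simp, by simp, fun q hq h => absurd h (not_le.2 (hfar q hq))⟩
    rw [ContinuousLinearMap.toLinearMap_zero, LinearMap.range_zero]
    infer_instance
  obtain ⟨f, b, hf, hb, hfb⟩ := hP p hp
  obtain ⟨hp1, hp2⟩ := hL_sphere p hp
  obtain ⟨g, hg, hgx⟩ := exists_dual_vector ℝ p.fst (by rw [← norm_ne_zero_iff, hp1]; norm_num)
  have hgx' : g p.fst = 1 := by simpa [hp1] using hgx
  -- The norm of `y*` need not be attained on the unit ball of `Y`; the approximation costs half of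
  -- the gap `δ`.
  obtain ⟨e, he, hpe⟩ : ∃ e : Y, ‖e‖ ≤ 1 ∧ 1 - δ / 2 < p.snd e := by
    obtain ⟨e, he, hpe⟩ := p.snd.exists_lt_apply_of_lt_opNorm
      (r := 1 - δ / 2) (by rw [hp2]; linarith)
    rcases abs_choice (p.snd e) with h | h
    · exact ⟨e, he.le, by rwa [Real.norm_eq_abs, h] at hpe⟩
    · exact ⟨-e, by rw [norm_neg]; exact he.le, by rw [map_neg]; rwa [Real.norm_eq_abs, h] at hpe⟩
  have happ : ∀ (h : StrongDual ℝ Y) (x : X),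
      h ((f.smulRight e + g.smulRight b) x) = f x * h e + g x * h b := by
    intro h x; simp
  have hlower : f p.fst + p.snd b - δ / 2 ≤ f p.fst * p.snd e + g p.fst * p.snd b := by
    have h1 := abs_le.1 (abs_apply_le_one hf hp1.le)
    have h2 := abs_le.1 (abs_apply_le_one hp2.le he)
    rw [hgx']
    nlinarith [h1.1, h1.2, h2.2]
  have hfar' : ∀ q ∈ L, ε ≤ signDist p q →
      |f q.fst * q.snd e + g q.fst * q.snd b| ≤
        f p.fst * p.snd e + g p.fst * p.snd b - δ / 2 := by
    intro q hq hqp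
    obtain ⟨hq1, hq2⟩ := hL_sphere q hq
    have h1 := hfb q hq hqp
    have h2 := mul_le_mul_of_nonneg_left (abs_apply_le_one hq2.le he) (abs_nonneg (f q.fst))
    have h3 := mul_le_mul_of_nonneg_right (abs_apply_le_one hg.le hq1.le) (abs_nonneg (q.snd b))
    have h4 := abs_add_le (f q.fst * q.snd e) (g q.fst * q.snd b)
    rw [abs_mul, abs_mul] at h4
    linarith
  refine ⟨f.smulRight e + g.smulRight b, ?_, ?_, ?_, fun q hq hqp => ?_⟩
  · have : FiniteDimensional ℝ (Submodule.span ℝ {e, b}) :=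
      FiniteDimensional.span_of_finite ℝ (Set.toFinite _)
    refine Submodule.finiteDimensional_of_le (S₂ := Submodule.span ℝ {e, b}) ?_
    rintro _ ⟨x, rfl⟩
    exact Submodule.mem_span_pair.2 ⟨f x, g x, by simp⟩
  · refine (norm_add_le _ _).trans ?_
    rw [ContinuousLinearMap.norm_smulRight_apply, ContinuousLinearMap.norm_smulRight_apply, hg]
    have := mul_le_one₀ hf (norm_nonneg e) he
    linarith
  · obtain ⟨q, hq, hqp⟩ := hfar
    rw [happ]
    linarith [hfar' q hq hqp, abs_nonneg (f q.fst * q.snd e + g q.fst * q.snd b)]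
  · rw [happ, happ]
    linarith [hfar' q hq hqp, min_le_left (δ / 2) 1]

/-! ### Small slices and strong maxima. -/

section Peaks

variable {V : Type*} [NormedAddCommGroup V] {L : Set V}
  {W : Type*} [NormedAddCommGroup W] [NormedSpace ℝ W]

theorem EvenBCF.norm_apply_le (Φ : EvenBCF L W) (q : L) : ‖Φ.1 q‖ ≤ ‖Φ‖ :=
  Φ.1.norm_coe_le_norm q

theorem EvenBCF.iSup_norm_eq (Φ : EvenBCF L W) : ⨆ q : L, ‖Φ.1 q‖ = ‖Φ‖ :=
  (Φ.1.norm_eq_iSup_norm).symm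

theorem EvenBCF.exists_lt_norm_apply (hL : L.Nonempty) (Φ : EvenBCF L W) {a : ℝ} (ha : a < ‖Φ‖) :
    ∃ q : L, a < ‖Φ.1 q‖ := by
  have := hL.to_subtype
  rw [← EvenBCF.iSup_norm_eq Φ] at ha
  exact exists_lt_of_lt_ciSup ha

/-- The points where the norm of `Φ` is close to its supremum lie `ε`-close, modulo sign, to a
single point. -/
def HasSmallSlice (Φ : EvenBCF L W) (ε : ℝ) : Prop :=
  ∃ p : L, ∃ η : ℝ, 0 < η ∧ ∀ q : L, ‖Φ‖ - η < ‖Φ.1 q‖ → signDist (p : V) q < ε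

/-- Otherwise some maximizing sequence stays `ε`-far from `±p`. -/
theorem AttainsStronglyModSign.hasSmallSlice {Φ : EvenBCF L W} (h : AttainsStronglyModSign Φ)
    {ε : ℝ} (hε : 0 < ε) : HasSmallSlice Φ ε := by
  obtain ⟨p, -, h⟩ := h
  refine ⟨p, ?_⟩
  by_contra! hcon
  choose u hu hup using fun n : ℕ => hcon (1 / ((n : ℝ) + 1)) Nat.one_div_pos_of_nat
  have hlim : Tendsto (fun n => ‖Φ.1 (u n)‖) atTop (𝓝 (⨆ x : L, ‖Φ.1 x‖)) := by
    rw [EvenBCF.iSup_norm_eq Φ]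
    refine tendsto_of_tendsto_of_tendsto_of_le_of_le
      (g := fun n : ℕ => ‖Φ‖ - 1 / ((n : ℝ) + 1)) ?_ tendsto_const_nhds
      (fun n => (hu n).le) fun n => EvenBCF.norm_apply_le Φ _
    simpa using tendsto_const_nhds.sub (tendsto_one_div_add_atTop_nhds_zero_nat (𝕜 := ℝ))
  obtain ⟨n, hn⟩ := ((h u hlim).eventually_lt_const hε).exists
  rw [signDist_comm] at hn
  exact absurd hn (not_lt.2 (hup n))

/-- On a complete symmetric set bounded away from `0`, small slices of all sizes produce a strong
maximum. -/
theorem AttainsStronglyModSign.of_hasSmallSlice [NormedSpace ℝ V] [CompleteSpace V] (hL_ne : L.Nonempty)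
    (hL_symm : ∀ p ∈ L, -p ∈ L) (hL_closed : IsClosed L) {ρ : ℝ} (hρ : 0 < ρ)
    (hL_norm : ∀ p ∈ L, ρ ≤ ‖p‖) {Φ : EvenBCF L W} {ε : ℕ → ℝ}
    (hε_lim : Tendsto ε atTop (𝓝 0)) (h : ∀ n, HasSmallSlice Φ (ε n)) :
    AttainsStronglyModSign Φ := by
  have hslice : ∀ c : ℝ, 0 < c → ∃ η : ℝ, 0 < η ∧ ∀ q q' : L, ‖Φ‖ - η < ‖Φ.1 q‖ →
      ‖Φ‖ - η < ‖Φ.1 q'‖ → signDist (q : V) q' < c := by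
    intro c hc
    obtain ⟨n, hn⟩ := (hε_lim.eventually_lt_const (half_pos hc)).exists
    obtain ⟨p, η, hη, hp⟩ := h n
    refine ⟨η, hη, fun q q' hq hq' => ?_⟩
    have h1 := signDist_triangle (q : V) p q'
    rw [signDist_comm (q : V) p] at h1
    linarith [hp q hq, hp q' hq']
  obtain ⟨n, hn⟩ := (hε_lim.eventually_lt_const (half_pos hρ)).exists
  obtain ⟨p, η₀, hη₀, hp⟩ := h n
  -- Evenness allows replacing `q` by `-q`, so the whole maximizing sequence can be taken near `p`
  -- rather than `-p`.
  have hex : ∀ n : ℕ, ∃ q : L, ‖Φ‖ - min η₀ (1 / ((n : ℝ) + 1)) < ‖Φ.1 q‖ ∧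
      ‖(p : V) - q‖ < ρ / 2 := by
    intro n
    obtain ⟨q, hq⟩ := EvenBCF.exists_lt_norm_apply hL_ne Φ
      (sub_lt_self ‖Φ‖ (lt_min hη₀ (Nat.one_div_pos_of_nat (n := n))))
    have hpq := (hp q (by linarith [min_le_left η₀ (1 / ((n : ℝ) + 1))])).trans hn
    rw [signDist_eq] at hpq
    rcases min_lt_iff.1 hpq with h' | h'
    · exact ⟨q, hq, h'⟩
    · refine ⟨⟨-q, hL_symm q q.2⟩, ?_, ?_⟩
      · rwa [Φ.2 q ⟨-q, hL_symm q q.2⟩ rfl]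
      · rwa [sub_neg_eq_add]
  choose u hu hup using hex
  have hmax : Tendsto (fun n => ‖Φ.1 (u n)‖) atTop (𝓝 ‖Φ‖) := by
    refine tendsto_of_tendsto_of_tendsto_of_le_of_le
      (g := fun n : ℕ => ‖Φ‖ - 1 / ((n : ℝ) + 1)) ?_ tendsto_const_nhds
      (fun n => ?_) fun n => EvenBCF.norm_apply_le Φ _
    · simpa using tendsto_const_nhds.sub (tendsto_one_div_add_atTop_nhds_zero_nat (𝕜 := ℝ))
    · have := min_le_right η₀ (1 / ((n : ℝ) + 1))
      have := hu n
      dsimp only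
      linarith
  have hcauchy : CauchySeq fun n => (u n : V) := by
    refine Metric.cauchySeq_iff.2 fun c hc => ?_
    obtain ⟨η, hη, hs⟩ := hslice (min c ρ) (lt_min hc hρ)
    obtain ⟨N, hN⟩ := eventually_atTop.1 (hmax.eventually_const_lt (sub_lt_self ‖Φ‖ hη))
    refine ⟨N, fun m hm k hk => ?_⟩
    have h1 := hs (u m) (u k) (hN m hm) (hN k hk)
    rw [signDist_eq] at h1
    rw [dist_eq_norm]
    rcases min_lt_iff.1 h1 with h' | h'
    · exact h'.trans_le (min_le_left _ _)
    -- If `u m` were close to both `u k` and `-u k`, then `2 ‖u m‖ < 2 ρ`.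
    · exfalso
      have h2 : ‖(u m : V) - u k‖ < ρ := by
        have := norm_sub_le_norm_sub_add_norm_sub (u m : V) p (u k)
        rw [norm_sub_rev (u m : V) p] at this
        linarith [hup m, hup k]
      have h3 : ‖(u m : V) + u m‖ ≤ ‖(u m : V) - u k‖ + ‖(u m : V) + u k‖ := by
        have := norm_add_le ((u m : V) - u k) ((u m : V) + u k)
        rwa [show (u m : V) - u k + (u m + u k) = u m + u m by abel] at this
      rw [← two_smul ℝ (u m : V), norm_smul, Real.norm_two] at h3
      linarith [hL_norm _ (u m).2, min_le_right c ρ]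
  obtain ⟨x, hx⟩ := cauchySeq_tendsto_of_complete hcauchy
  have hxL : x ∈ L := hL_closed.mem_of_tendsto hx (Eventually.of_forall fun n => (u n).2)
  have hx' : Tendsto u atTop (𝓝 ⟨x, hxL⟩) := tendsto_subtype_rng.2 hx
  have hval : ‖Φ.1 ⟨x, hxL⟩‖ = ‖Φ‖ :=
    tendsto_nhds_unique ((Φ.1.continuous.norm.tendsto _).comp hx') hmax
  refine ⟨⟨x, hxL⟩, by rw [EvenBCF.iSup_norm_eq Φ, hval], fun v hv => ?_⟩
  rw [EvenBCF.iSup_norm_eq Φ] at hv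
  refine Metric.tendsto_atTop.2 fun c hc => ?_
  obtain ⟨η, hη, hs⟩ := hslice c hc
  obtain ⟨N, hN⟩ := eventually_atTop.1 (hv.eventually_const_lt (sub_lt_self ‖Φ‖ hη))
  refine ⟨N, fun m hm => ?_⟩
  rw [Real.dist_eq, sub_zero, abs_of_nonneg (signDist_nonneg _ _)]
  exact hs (v m) ⟨x, hxL⟩ (hN m hm) (by rw [hval]; linarith)

/-! ### Perturbation by peak functions. -/

variable {Z : Type*} [NormedAddCommGroup Z] [NormedSpace ℝ Z] (ι : Z →ₗ[ℝ] EvenBCF L W)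

/-- `Z` contains, for every `p ∈ L` and every direction `w`, a function of norm at most `2` that
peaks at `p` in the direction `w`, with gap `δ` outside the `ε`-neighbourhood of `±p`. -/
def HasPeaks (ε δ : ℝ) : Prop :=
  ∀ (p : L) (w : W), ‖w‖ = 1 → ∃ (Ξ : Z) (c : ℝ), ‖Ξ‖ ≤ 2 ∧ 0 ≤ c ∧ (ι Ξ).1 p = c • w ∧
    ∀ q : L, ε ≤ signDist (p : V) q → ‖(ι Ξ).1 q‖ ≤ c - δ

variable {ι}

/-- Adding a small multiple of a peak function at a near-maximum point `p` forces, stably, all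
near-maximum points to be close to `±p`. -/
theorem HasPeaks.exists_perturbation [Nontrivial W] (hι_norm : ∀ Φ : Z, ‖ι Φ‖ ≤ ‖Φ‖) {ε δ : ℝ}
    (h : HasPeaks ι ε δ) (Θ : EvenBCF L W) (Φ : Z) (p : L) {s : ℝ} (hs : 0 < s)
    (hp : ‖Θ + ι Φ‖ - s * δ / 4 < ‖(Θ + ι Φ).1 p‖) :
    ∃ Φ₁ : Z, ‖Φ₁ - Φ‖ ≤ 2 * s ∧ ∀ Φ₂ : Z, ‖Φ₂ - Φ₁‖ < s * δ / 8 →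
      ∀ q : L, ‖Θ + ι Φ₂‖ - s * δ / 4 < ‖(Θ + ι Φ₂).1 q‖ → signDist (p : V) q < ε := by
  -- With `w` along the value at `p`, the norms of that value and of the added peak add up exactly.
  obtain ⟨w, hw, hwp⟩ : ∃ w : W, ‖w‖ = 1 ∧ (Θ + ι Φ).1 p = ‖(Θ + ι Φ).1 p‖ • w := by
    by_cases h0 : (Θ + ι Φ).1 p = 0
    · obtain ⟨w, hw⟩ := exists_norm_eq W zero_le_one
      exact ⟨w, hw, by rw [h0]; simp⟩
    · refine ⟨‖(Θ + ι Φ).1 p‖⁻¹ • (Θ + ι Φ).1 p, norm_smul_inv_norm h0, ?_⟩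
      rw [smul_inv_smul₀ (norm_ne_zero_iff.2 h0)]
  obtain ⟨Ξ, c, hΞ, hc, hΞp, hΞq⟩ := h p w hw
  refine ⟨Φ + s • Ξ, ?_, fun Φ₂ hΦ₂ q hq => ?_⟩
  · rw [add_sub_cancel_left, norm_smul, Real.norm_eq_abs, abs_of_pos hs]
    nlinarith
  have hdecomp : ∀ q : L, (Θ + ι Φ₂).1 q =
      (Θ + ι Φ).1 q + s • (ι Ξ).1 q + (ι (Φ₂ - (Φ + s • Ξ))).1 q := by
    intro q
    have : Θ + ι Φ₂ = Θ + ι Φ + s • ι Ξ + ι (Φ₂ - (Φ + s • Ξ)) := by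
      simp only [map_sub, map_add, map_smul]; abel
    rw [this]; rfl
  have hrem : ∀ q : L, ‖(ι (Φ₂ - (Φ + s • Ξ))).1 q‖ < s * δ / 8 := fun q =>
    ((EvenBCF.norm_apply_le _ q).trans (hι_norm _)).trans_lt hΦ₂
  have hlow : ‖(Θ + ι Φ).1 p‖ + s * c - s * δ / 8 < ‖(Θ + ι Φ₂).1 p‖ := by
    have h1 : ‖(Θ + ι Φ).1 p + s • (ι Ξ).1 p‖ = ‖(Θ + ι Φ).1 p‖ + s * c := by
      rw [hΞp, smul_smul]
      nth_rw 1 [hwp]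
      rw [← add_smul, norm_smul, hw, mul_one, Real.norm_eq_abs,
        abs_of_nonneg (by positivity)]
    have h2 := norm_sub_le_norm_add ((Θ + ι Φ).1 p + s • (ι Ξ).1 p)
      ((ι (Φ₂ - (Φ + s • Ξ))).1 p)
    rw [← hdecomp, h1] at h2
    linarith [hrem p]
  -- A far `q` in the slice would have norm at most `‖Θ + ι Φ‖ + s * c - 7 * s * δ / 8`, yet more
  -- than `‖Θ + ι Φ‖ + s * c - 5 * s * δ / 8`.
  by_contra! hfar
  have hup : ‖(Θ + ι Φ₂).1 q‖ ≤ ‖Θ + ι Φ‖ + s * (c - δ) + s * δ / 8 := by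
    rw [hdecomp]
    refine (norm_add₃_le).trans ?_
    rw [norm_smul, Real.norm_eq_abs, abs_of_pos hs]
    have := mul_le_mul_of_nonneg_left (hΞq q hfar) hs.le
    linarith [hrem q, EvenBCF.norm_apply_le (Θ + ι Φ) q]
  have := EvenBCF.norm_apply_le (Θ + ι Φ₂) p
  have hsδ : 0 < s * δ := by
    linarith [(norm_nonneg _).trans_lt hΦ₂]
  linarith

/-- If `Z` contains peak functions, the set of perturbations without `ε`-small slice is porous. -/
theorem HasPeaks.isPorousIn [Nontrivial W] (hL_ne : L.Nonempty) (hι_norm : ∀ Φ : Z, ‖ι Φ‖ ≤ ‖Φ‖)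
    {ε δ : ℝ} (hδ : 0 < δ) (hδ1 : δ ≤ 1) (h : HasPeaks ι ε δ) (Θ : EvenBCF L W) :
    IsPorousIn {Φ : Z | ¬ HasSmallSlice (Θ + ι Φ) ε} := by
  -- With `s = r / 4`, the centre moves by at most `r / 2` and the stability radius `s * δ / 8` is
  -- `δ / 32 * r`.
  refine ⟨δ / 32, by positivity, by linarith, 1, one_pos, fun Φ r hr _ => ?_⟩
  have hsδ : 0 < r / 4 * δ / 4 := by positivity
  obtain ⟨p, hp⟩ := EvenBCF.exists_lt_norm_apply hL_ne (Θ + ι Φ) (sub_lt_self ‖Θ + ι Φ‖ hsδ)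
  obtain ⟨Φ₁, hΦ₁, h₁⟩ := h.exists_perturbation hι_norm Θ Φ p (by positivity : 0 < r / 4) hp
  refine ⟨Φ₁, fun Φ₂ hΦ₂ => ⟨?_, ?_⟩⟩ <;> rw [Metric.mem_ball, dist_eq_norm] at hΦ₂
  · rw [Metric.mem_ball, dist_eq_norm]
    have := norm_sub_le_norm_sub_add_norm_sub Φ₂ Φ₁ Φ
    nlinarith
  · rw [mem_compl_iff, mem_ofPred_eq, not_not]
    exact ⟨p, _, hsδ, h₁ Φ₂ (by linarith)⟩

end Peaks

/-! ### The main theorem. -/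

/-- The Banach space `Z` included in the space of bounded continuous even maps is given as a
Banach space with an injective linear map `ι` into that space. -/
theorem theorem3p9
    {X Y W Z : Type*}
    [NormedAddCommGroup X] [NormedSpace ℝ X] [CompleteSpace X]
    [NormedAddCommGroup Y] [NormedSpace ℝ Y] [CompleteSpace Y]
    [NormedAddCommGroup W] [NormedSpace ℝ W] [CompleteSpace W] [Nontrivial W]
    [NormedAddCommGroup Z] [NormedSpace ℝ Z] [CompleteSpace Z]
    (L : Set (ProdDual X Y))
    (hL_ne : L.Nonempty)
    (hL_symm : ∀ p ∈ L, -p ∈ L)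
    (hL_closed : IsClosed L)
    (hL_sphere : ∀ p ∈ L, ‖p.fst‖ = 1 ∧ ‖p.snd‖ = 1)
    (hL_P : HasPropertyP L)
    (ι : Z →ₗ[ℝ] EvenBCF L W)
    (hι_inj : Function.Injective ι)
    (hι_norm : ∀ Φ : Z, ‖ι Φ‖ ≤ ‖Φ‖)
    (hι_tensor : ∀ T : X →L[ℝ] Y, FiniteDimensional ℝ (T : X →ₗ[ℝ] Y).range → ∀ w : W,
      ∃ Φ : Z, (∀ p : L, (ι Φ).1 p = opTensor T w p) ∧ ‖Φ‖ ≤ ‖T‖ * ‖w‖) :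
    (∀ Θ : EvenBCF L W,
      ∃ A : Set Z, IsSigmaPorousIn A ∧ {Φ : Z | AttainsStronglyModSign (Θ + ι Φ)} = Aᶜ) ∧
    (∀ ε : ℝ, 0 < ε → ∃ η : ℝ, 0 < η ∧
      ∀ (Φ : Z) (p : L), ‖ι Φ‖ = 1 → 1 - η < ‖(ι Φ).1 p‖ →
        ∃ (Ψ : Z) (q : L), ‖ι Ψ‖ = 1 ∧ ‖(ι Ψ).1 q‖ = 1 ∧
          ‖p.1.fst - q.1.fst‖ + ‖p.1.snd - q.1.snd‖ < ε ∧ ‖ι Ψ - ι Φ‖ < ε) := by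
  have hL_norm : ∀ p ∈ L, (1 : ℝ) ≤ ‖p‖ := fun p hp => by
    rw [WithLp.prod_norm_eq_of_L1]
    linarith [(hL_sphere p hp).1, norm_nonneg p.snd]
  obtain ⟨ε₀, hε₀, hpeak⟩ := hL_P.exists_peak_operator hL_sphere
  have hpeaks : ∀ ε : ℝ, 0 < ε → ε < ε₀ → ∃ δ : ℝ, 0 < δ ∧ δ ≤ 1 ∧ HasPeaks ι ε δ := by
    intro ε hε hlt
    obtain ⟨δ, hδ, hδ1, hT⟩ := hpeak ε hε hlt
    refine ⟨δ, hδ, hδ1, fun p w hw => ?_⟩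
    obtain ⟨T, hTfin, hT2, hT0, hTq⟩ := hT p p.2
    obtain ⟨Ξ, hΞ, hΞn⟩ := hι_tensor T hTfin w
    refine ⟨Ξ, p.1.snd (T p.1.fst), ?_, hT0, hΞ p, fun q hq => ?_⟩
    · rw [hw, mul_one] at hΞn
      exact hΞn.trans hT2
    · rw [hΞ q, opTensor, norm_smul, hw, mul_one]
      exact hTq q q.2 hq
  have hporous : ∀ Θ : EvenBCF L W,
      ∃ A : Set Z, IsSigmaPorousIn A ∧ {Φ : Z | AttainsStronglyModSign (Θ + ι Φ)} = Aᶜ := by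
    intro Θ
    have hpos : ∀ n : ℕ, 0 < ε₀ / 2 * (1 / ((n : ℝ) + 1)) := fun n => by positivity
    have hlt : ∀ n : ℕ, ε₀ / 2 * (1 / ((n : ℝ) + 1)) < ε₀ := fun n => by
      have : 1 / ((n : ℝ) + 1) ≤ 1 := by
        rw [div_le_one (by positivity)]; linarith [n.cast_nonneg (α := ℝ)]
      nlinarith
    refine ⟨_, ⟨fun n => {Φ : Z | ¬ HasSmallSlice (Θ + ι Φ) (ε₀ / 2 * (1 / ((n : ℝ) + 1)))},
      fun n => ?_, rfl⟩, ?_⟩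
    · obtain ⟨δ, hδ, hδ1, h⟩ := hpeaks _ (hpos n) (hlt n)
      exact h.isPorousIn hL_ne hι_norm hδ hδ1 Θ
    · ext Φ
      simp only [mem_ofPred_eq, mem_compl_iff, mem_iUnion, not_exists, not_not]
      refine ⟨fun h n => h.hasSmallSlice (hpos n), fun h => ?_⟩
      refine AttainsStronglyModSign.of_hasSmallSlice hL_ne hL_symm hL_closed one_pos hL_norm ?_ h
      simpa using (tendsto_one_div_add_atTop_nhds_zero_nat (𝕜 := ℝ)).const_mul (ε₀ / 2)
  refine ⟨hporous, fun ε hε => ?_⟩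
  obtain ⟨ε₁, hε₁, hε₁'⟩ := exists_between (lt_min hε hε₀)
  obtain ⟨δ, hδ, -, hpk⟩ := hpeaks ε₁ hε₁ (hε₁'.trans_le (min_le_right _ _))
  -- The factor `2` pays for normalization, which moves `ι Φ₂` by at most its distance to `ι Φ`; the
  -- bound `1` keeps `ι Φ₂` nonzero.
  obtain ⟨s, hs, hs'⟩ : ∃ s : ℝ, 0 < s ∧ (2 * s + s * δ / 8) * 2 < min ε 1 := by
    refine ⟨min ε 1 / (2 * (4 + δ / 4)), by positivity, ?_⟩
    rw [show (2 * (min ε 1 / (2 * (4 + δ / 4))) + min ε 1 / (2 * (4 + δ / 4)) * δ / 8) * 2 =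
      min ε 1 / 2 by field_simp; ring]
    exact half_lt_self (by positivity)
  refine ⟨s * δ / 4, by positivity, fun Φ p hΦ hp => ?_⟩
  obtain ⟨Φ₁, hΦ₁, h₁⟩ := hpk.exists_perturbation hι_norm 0 Φ p hs (by
    rwa [zero_add, hΦ])
  obtain ⟨A, hA, hAeq⟩ := hporous 0
  obtain ⟨Φ₂, hΦ₂A, hΦ₂⟩ := hA.dense_compl.exists_dist_lt Φ₁ (by positivity : 0 < s * δ / 8)
  rw [dist_comm, dist_eq_norm] at hΦ₂
  rw [← hAeq, mem_ofPred_eq, zero_add] at hΦ₂A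
  obtain ⟨q, hq, -⟩ := hΦ₂A
  rw [EvenBCF.iSup_norm_eq] at hq
  have hdist : ‖ι Φ₂ - ι Φ‖ ≤ 2 * s + s * δ / 8 := by
    rw [← map_sub]
    refine (hι_norm _).trans ((norm_sub_le_norm_sub_add_norm_sub Φ₂ Φ₁ Φ).trans ?_)
    linarith
  have hone : |‖ι Φ₂‖ - 1| ≤ ‖ι Φ₂ - ι Φ‖ := by
    rw [← hΦ]; exact abs_norm_sub_norm_le _ _
  have hpos : 0 < ‖ι Φ₂‖ := by
    linarith [(abs_le.1 hone).1, min_le_right ε 1]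
  have hnorm : ‖ι (‖ι Φ₂‖⁻¹ • Φ₂)‖ = 1 := by
    rw [map_smul]; exact norm_smul_inv_norm (norm_pos_iff.1 hpos)
  have hval : ∀ q : L, ‖(ι Φ₂).1 q‖ = ‖ι Φ₂‖ → ‖(ι (‖ι Φ₂‖⁻¹ • Φ₂)).1 q‖ = 1 := by
    intro q hq
    rw [map_smul]
    change ‖‖ι Φ₂‖⁻¹ • (ι Φ₂).1 q‖ = 1
    rw [norm_smul, norm_inv, norm_norm, hq, inv_mul_cancel₀ hpos.ne']
  have hclose : ‖ι (‖ι Φ₂‖⁻¹ • Φ₂) - ι Φ‖ < ε := by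
    have h1 : ‖ι (‖ι Φ₂‖⁻¹ • Φ₂) - ι Φ₂‖ = |‖ι Φ₂‖ - 1| := by
      have : ι (‖ι Φ₂‖⁻¹ • Φ₂) - ι Φ₂ = (1 - ‖ι Φ₂‖) • ι (‖ι Φ₂‖⁻¹ • Φ₂) := by
        rw [← map_sub, ← map_smul, sub_smul, one_smul, smul_inv_smul₀ hpos.ne']
      rw [this, norm_smul, hnorm, mul_one, Real.norm_eq_abs, abs_sub_comm]
    have := norm_sub_le_norm_sub_add_norm_sub (ι (‖ι Φ₂‖⁻¹ • Φ₂)) (ι Φ₂) (ι Φ)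
    linarith [min_le_left ε 1]
  have hpq := h₁ Φ₂ hΦ₂ q (by rw [zero_add, ← hq]; exact sub_lt_self _ (by positivity))
  have hsum : ∀ a : ProdDual X Y, ‖p.1 - a‖ = ‖p.1.fst - a.fst‖ + ‖p.1.snd - a.snd‖ :=
    fun a => WithLp.prod_norm_eq_of_L1 _
  rw [signDist_eq] at hpq
  have hε₁ε := hε₁'.trans_le (min_le_left _ _)
  -- The maximum point is located only up to sign; by evenness `-q` is also one.
  rcases min_lt_iff.1 hpq with h | h
  · exact ⟨_, q, hnorm, hval q hq.symm, by rw [← hsum]; exact h.trans hε₁ε, hclose⟩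
  · refine ⟨_, ⟨-q, hL_symm q q.2⟩, hnorm, hval _ ?_, ?_, hclose⟩
    · rw [(ι Φ₂).2 q ⟨-q, hL_symm q q.2⟩ rfl, hq]
    · rw [← hsum, sub_neg_eq_add]; exact h.trans hε₁ε
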